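/- Let $$P(x_1,\dots,x_5)=x_1x_4+x_2x_5+x_2x_3x_4-x_1x_2x_3x_4-x_1x_2x_4x_5-x_2x_3x_4x_5+x_1x_2x_3x_4x_5$$ be the reliability polynomial of the bridge network, and let $\mathcal H=\{x\in\mathbb R^6 : x_6=P(x_1,\dots,x_5)\}$ be its graph, the reliability hypersurface. Then the family $\mathcal F$ of all straight lines contained in $\mathcal H$ (each line regarded as a set of points) depends on at least five and at most six parameters, in the following sense. A smooth $k$-parameter family of lines consists of an open set $U\subseteq\mathbb R^k$ and $C^\infty$ maps $a,b:U\to\mathbb R^6$ with $a(u)\neq 0$ for all $u\in U$; its members are the lines $\ell_u=\{t\,a(u)+b(u): t\in\mathbb R\}$. Its parameters are called essential if $u\mapsto \ell_u$ is injective and is an immersion into the manifold of lines, i.e. if for $u\in U$ and $w\in\mathbb R^k$ the conditions $Da(u)w\in\mathbb R\,a(u)$ and $Db(u)w\in\mathbb R\,a(u)$ imply $w=0$. 1. (At least five.) There is a smooth family of lines with five essential parameters and nonempty $U\subseteq\mathbb R^5$, all of whose members belong to $\mathcal F$. 2. (At most six.) $\mathcal F$ is the union of finitely many smooth $6$-parameter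 families of lines (whose parameters need not be essential). -/

import Mathlib

open scoped ContDiff

noncomputable section

/-- The reliability polynomial of the bridge network. The variable `X i` (`i = 0, …, 4`) is the
reliability `R_{i+1}` of the `(i+1)`-st component. -/
def bridgePolynomial : MvPolynomial (Fin 5) ℝ :=
  .X 0 * .X 3 + .X 1 * .X 4 + .X 1 * .X 2 * .X 3
    - .X 0 * .X 1 * .X 2 * .X 3 - .X 0 * .X 1 * .X 3 * .X 4 - .X 1 * .X 2 * .X 3 * .X 4
    + .X 0 * .X 1 * .X 2 * .X 3 * .X 4

/-- The reliability hypersurface: the graph of the reliability polynomial in `ℝ⁶`. The last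
coordinate is the value of the polynomial. -/
def reliabilityHypersurface : Set (Fin 6 → ℝ) :=
  {x | x 5 = MvPolynomial.eval (fun i : Fin 5 => x i.castSucc) bridgePolynomial}

/-- The set of all points `t a + b`, `t ∈ ℝ` (a straight line if `a ≠ 0`). -/
def lineSet {n : ℕ} (a b : Fin n → ℝ) : Set (Fin n → ℝ) :=
  Set.range fun t : ℝ => t • a + b

/-- The straight lines contained in `S`, each line being regarded as a set of points. -/
def linesIn {n : ℕ} (S : Set (Fin n → ℝ)) : Set (Set (Fin n → ℝ)) :=
  {L | (∃ a b : Fin n → ℝ, a ≠ 0 ∧ L = lineSet a b) ∧ L ⊆ S}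

/-- A smooth `k`-parameter family of straight lines `t ↦ t a(u) + b(u)`, with `u` running through
an open set `U` of `ℝᵏ`. -/
structure IsSmoothLineFamily {k n : ℕ} (U : Set (Fin k → ℝ))
    (a b : (Fin k → ℝ) → (Fin n → ℝ)) : Prop where
  isOpen : IsOpen U
  smooth_direction : ContDiffOn ℝ ∞ a U
  smooth_point : ContDiffOn ℝ ∞ b U
  direction_ne_zero : ∀ u ∈ U, a u ≠ 0

/-- All `k` parameters of the family are essential: different parameters give different lines, and
the map from parameters to lines has Jacobian rank `k` everywhere. Since `(a, b)` and
`(α a, b + β a)`, `α ≠ 0`, describe the same line, an infinitesimal change `(a', b')` of `(a, b)`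
leaves the line fixed to first order exactly if `a'` and `b'` are multiples of `a`. -/
structure HasEssentialParameters {k n : ℕ} (U : Set (Fin k → ℝ))
    (a b : (Fin k → ℝ) → (Fin n → ℝ)) : Prop where
  injOn : Set.InjOn (fun u => lineSet (a u) (b u)) U
  full_rank : ∀ u ∈ U, ∀ w : Fin k → ℝ,
    fderiv ℝ a u w ∈ Submodule.span ℝ {a u} →
    fderiv ℝ b u w ∈ Submodule.span ℝ {a u} → w = 0

/-- The family `F` of straight lines depends on at least `k` parameters: it contains a nonempty
smooth family with `k` essential parameters. -/
def DependsOnAtLeast {n : ℕ} (F : Set (Set (Fin n → ℝ))) (k : ℕ) : Prop :=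
  ∃ (U : Set (Fin k → ℝ)) (a b : (Fin k → ℝ) → (Fin n → ℝ)),
    U.Nonempty ∧ IsSmoothLineFamily U a b ∧ HasEssentialParameters U a b ∧
      ∀ u ∈ U, lineSet (a u) (b u) ∈ F

/-- The family `F` of straight lines depends on at most `k` parameters: it is the union of finitely
many smooth families with `k` parameters (which need not be essential). -/
def DependsOnAtMost {n : ℕ} (F : Set (Set (Fin n → ℝ))) (k : ℕ) : Prop :=
  ∃ (m : ℕ) (U : Fin m → Set (Fin k → ℝ)) (a b : Fin m → (Fin k → ℝ) → (Fin n → ℝ)),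
    (∀ j, IsSmoothLineFamily (U j) (a j) (b j)) ∧
      F = ⋃ j, (fun u => lineSet (a j u) (b j u)) '' U j

end

/-! Coordinates are numbered from 0 as in the code. A line `t a + b` lies in the hypersurface iff P
along it has degree at most one in t, with `a 5`, `b 5` its coefficients. At least five: for x₁ = 0
one has P = x₀x₃, so with x₃ constant the coordinates x₂ and x₄ may be any affine functions of x₀.
At most six: the coefficient of t⁵ is a₀a₁a₂a₃a₄, so some coordinate is constant. By
`two_fixed_or_third_fixed`, either two are constant or only x₂ is. In the first case the two
constants and the normalized motion of the other three coordinates make six parameters, subject to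
two equations; `SmoothlyParametrized.cubicConditions` splits the solution set into finitely many
smooth pieces. The second case leaves an explicit family with four effective parameters
(`coveredLines_third_fixed`). -/

/-! ### Finite unions of smooth images -/

/-- `S` is a finite union of images of open subsets of `E` under smooth maps. -/
inductive SmoothlyParametrized (E : Type*) [NormedAddCommGroup E] [NormedSpace ℝ E]
    {X : Type*} [NormedAddCommGroup X] [NormedSpace ℝ X] : Set X → Prop
  | empty : SmoothlyParametrized E ∅
  | image {U : Set E} {f : E → X} (hU : IsOpen U) (hf : ContDiffOn ℝ ∞ f U) :
      SmoothlyParametrized E (f '' U)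
  | union {S T : Set X} (hS : SmoothlyParametrized E S) (hT : SmoothlyParametrized E T) :
      SmoothlyParametrized E (S ∪ T)

namespace SmoothlyParametrized

variable {E : Type*} [NormedAddCommGroup E] [NormedSpace ℝ E]
  {F : Type*} [NormedAddCommGroup F] [NormedSpace ℝ F]
  {X : Type*} [NormedAddCommGroup X] [NormedSpace ℝ X]
  {Y : Type*} [NormedAddCommGroup Y] [NormedSpace ℝ Y]

theorem univ : SmoothlyParametrized E (Set.univ : Set E) := by
  simpa using SmoothlyParametrized.image (E := E) (f := id) isOpen_univ contDiffOn_id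

theorem singleton (x : X) : SmoothlyParametrized E ({x} : Set X) := by
  simpa [Set.Nonempty.image_const Set.univ_nonempty] using
    SmoothlyParametrized.image (E := E) (f := fun _ => x) isOpen_univ contDiffOn_const

theorem biUnion {ι : Type*} {s : Set ι} (hs : s.Finite) {T : ι → Set X}
    (hT : ∀ i ∈ s, SmoothlyParametrized E (T i)) : SmoothlyParametrized E (⋃ i ∈ s, T i) := by
  induction s, hs using Set.Finite.induction_on with
  | empty => simpa using SmoothlyParametrized.empty
  | insert _ _ ih =>
    rw [Set.biUnion_insert]
    exact (hT _ (Set.mem_insert _ _)).union (ih fun i hi => hT i (Set.mem_insert_of_mem _ hi))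

theorem of_finite {S : Set X} (hS : S.Finite) : SmoothlyParametrized E S := by
  simpa using biUnion (E := E) hS (T := fun x => {x}) fun x _ => singleton x

theorem image_inter {S : Set X} (hS : SmoothlyParametrized E S) {W : Set X} (hW : IsOpen W)
    {g : X → Y} (hg : ContDiffOn ℝ ∞ g W) : SmoothlyParametrized E (g '' (S ∩ W)) := by
  induction hS with
  | empty => simpa using SmoothlyParametrized.empty
  | @image U f hU hf =>
    have h : g '' (f '' U ∩ W) = (g ∘ f) '' (U ∩ f ⁻¹' W) := by
      rw [Set.image_comp, Set.image_inter_preimage]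
    rw [h]
    exact .image (hf.continuousOn.isOpen_inter_preimage hU hW)
      (hg.comp (hf.mono Set.inter_subset_left) fun _ hx => hx.2)
  | union _ _ ihS ihT =>
    rw [Set.union_inter_distrib_right, Set.image_union]
    exact ihS.union ihT

theorem image_of_contDiff {S : Set X} (hS : SmoothlyParametrized E S) {g : X → Y}
    (hg : ContDiff ℝ ∞ g) : SmoothlyParametrized E (g '' S) := by
  simpa using hS.image_inter isOpen_univ hg.contDiffOn

/-- Adds dummy parameters, so that pieces of lower dimension count as pieces of full dimension. -/
theorem of_surjective {S : Set X} (hS : SmoothlyParametrized E S) (π : F →L[ℝ] E)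
    (hπ : Function.Surjective π) : SmoothlyParametrized F S := by
  induction hS with
  | empty => exact .empty
  | @image U f hU hf =>
    have h : f '' U = (f ∘ π) '' (π ⁻¹' U) := by
      rw [Set.image_comp, Set.image_preimage_eq _ hπ]
    rw [h]
    exact .image (hU.preimage π.continuous) (hf.comp π.contDiff.contDiffOn fun _ hx => hx)
  | union _ _ ihS ihT => exact ihS.union ihT

theorem prod_univ {S : Set X} (hS : SmoothlyParametrized E S) :
    SmoothlyParametrized (E × F) (S ×ˢ (Set.univ : Set F)) := by
  induction hS with
  | empty => simpa using SmoothlyParametrized.empty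
  | @image U f hU hf =>
    have h : (f '' U) ×ˢ (Set.univ : Set F) = Prod.map f id '' (U ×ˢ Set.univ) := by
      rw [Set.prodMap_image_prod, Set.image_id]
    rw [h]
    exact .image (hU.prod isOpen_univ) (hf.prodMap contDiffOn_id)
  | union _ _ ihS ihT =>
    rw [Set.union_prod]
    exact ihS.union ihT

theorem dependsOnAtMost {k n : ℕ} {S : Set ((Fin n → ℝ) × (Fin n → ℝ))}
    (hS : SmoothlyParametrized (Fin k → ℝ) S) (h0 : ∀ p ∈ S, p.1 ≠ 0) :
    DependsOnAtMost ((fun p => lineSet p.1 p.2) '' S) k := by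
  induction hS with
  | empty => exact ⟨0, fun _ => ∅, fun _ _ => 0, fun _ _ => 0, fun j => j.elim0, by simp⟩
  | @image U f hU hf =>
    refine ⟨1, fun _ => U, fun _ u => (f u).1, fun _ u => (f u).2, fun _ => ⟨hU, ?_, ?_, ?_⟩, ?_⟩
    · exact contDiff_fst.comp_contDiffOn hf
    · exact contDiff_snd.comp_contDiffOn hf
    · exact fun u hu => h0 _ (Set.mem_image_of_mem _ hu)
    · simp [Set.image_image, Set.iUnion_const]
  | union _ _ ihS ihT =>
    obtain ⟨m, U, a, b, h, e⟩ := ihS fun p hp => h0 p (Or.inl hp)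
    obtain ⟨m', U', a', b', h', e'⟩ := ihT fun p hp => h0 p (Or.inr hp)
    refine ⟨m + m', Fin.append U U', Fin.append a a', Fin.append b b', ?_, ?_⟩
    · intro j
      induction j using Fin.addCases with
      | left j => simpa using h j
      | right j => simpa using h' j
    · rw [Set.image_union, e, e']
      ext L
      simp only [Set.mem_union, Set.mem_iUnion]
      constructor
      · rintro (⟨j, hj⟩ | ⟨j, hj⟩)
        · exact ⟨Fin.castAdd m' j, by simpa using hj⟩
        · exact ⟨Fin.natAdd m j, by simpa using hj⟩
      · rintro ⟨j, hj⟩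
        induction j using Fin.addCases with
        | left j => exact Or.inl ⟨j, by simpa using hj⟩
        | right j => exact Or.inr ⟨j, by simpa using hj⟩

/-- The common zero set of a family of polynomials in one variable. -/
theorem polynomial_zeros (S : Set (Polynomial ℝ)) :
    SmoothlyParametrized ℝ {x : ℝ | ∀ p ∈ S, p.eval x = 0} := by
  by_cases h : ∀ p ∈ S, p = 0
  · convert SmoothlyParametrized.univ (E := ℝ)
    ext x
    simp only [Set.mem_ofPred_eq, Set.mem_univ, iff_true]
    intro p hp
    simp [h p hp]
  · push Not at h
    obtain ⟨p, hp, hp0⟩ := h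
    exact of_finite ((Polynomial.finite_setOfPred_isRoot hp0).subset fun x hx => hx p hp)

end SmoothlyParametrized

/-! ### Common zeros of biaffine polynomials in the plane -/

/-- The polynomial `q₀ + q₁ x + q₂ y + q₃ x y` in the coordinates of `z = (x, y)`. -/
def biaffine (q : Fin 4 → ℝ) (z : ℝ × ℝ) : ℝ :=
  q 0 + q 1 * z.1 + q 2 * z.2 + q 3 * (z.1 * z.2)

theorem contDiff_biaffine (q : Fin 4 → ℝ) : ContDiff ℝ ∞ (biaffine q) := by
  unfold biaffine
  fun_prop

open Polynomial in
-- Pick a nonzero p = r(x) + l(x) y in the system. Where l ≠ 0, p gives y = -r/l and the other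
-- equations become polynomial conditions on x. Where l = 0, also r = 0, which leaves finitely many
-- vertical lines, each meeting the zero set in all or finitely many of its points.
theorem SmoothlyParametrized.biaffine_zeros (S : Set (Fin 4 → ℝ)) :
    SmoothlyParametrized (ℝ × ℝ) {z : ℝ × ℝ | ∀ q ∈ S, biaffine q z = 0} := by
  by_cases h : ∀ q ∈ S, q = 0
  · convert SmoothlyParametrized.univ (E := ℝ × ℝ)
    ext x
    simp only [Set.mem_ofPred_eq, Set.mem_univ, iff_true]
    intro q hq
    simp [biaffine, h q hq]
  push Not at h
  obtain ⟨p, hp, hp0⟩ := h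
  set l : ℝ[X] := C (p 2) + C (p 3) * X with hl
  set r : ℝ[X] := C (p 0) + C (p 1) * X with hr
  have hlx : ∀ x, l.eval x = p 2 + p 3 * x := by simp [hl]
  have hrx : ∀ x, r.eval x = p 0 + p 1 * x := by simp [hr]
  -- The resultants in y of p with the members of S.
  set T : Set ℝ[X] :=
    (fun q : Fin 4 → ℝ => (C (q 0) + C (q 1) * X) * l - (C (q 2) + C (q 3) * X) * r) '' S
  have h1 : SmoothlyParametrized (ℝ × ℝ) ((fun x : ℝ => (x, -r.eval x / l.eval x)) ''
      ({x : ℝ | ∀ q ∈ T, q.eval x = 0} ∩ {x | l.eval x ≠ 0})) := by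
    refine ((SmoothlyParametrized.polynomial_zeros T).image_inter
      (isOpen_ne_fun l.continuous continuous_const) ?_).of_surjective
      (ContinuousLinearMap.fst ℝ ℝ ℝ) Prod.fst_surjective
    have hlc : ContDiff ℝ ∞ fun x => l.eval x := by simp only [hlx]; fun_prop
    have hrc : ContDiff ℝ ∞ fun x => r.eval x := by simp only [hrx]; fun_prop
    exact contDiffOn_id.prodMk (hrc.neg.contDiffOn.div hlc.contDiffOn fun _ hx => hx)
  have hfin : {x : ℝ | l.eval x = 0 ∧ r.eval x = 0}.Finite := by
    by_cases hl0 : l = 0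
    · have hr0 : r ≠ 0 := by
        intro hr0
        apply hp0
        have e1 := congrArg (coeff · 0) hl0
        have e2 := congrArg (coeff · 1) hl0
        have e3 := congrArg (coeff · 0) hr0
        have e4 := congrArg (coeff · 1) hr0
        simp [hl, hr] at e1 e2 e3 e4
        ext i
        fin_cases i <;> simp [*]
      exact (finite_setOfPred_isRoot hr0).subset fun x hx => hx.2
    · exact (finite_setOfPred_isRoot hl0).subset fun x hx => hx.1
  have h2 : SmoothlyParametrized (ℝ × ℝ) (⋃ x ∈ {x : ℝ | l.eval x = 0 ∧ r.eval x = 0},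
      (fun y : ℝ => (x, y)) '' {y | ∀ f ∈ (fun q : Fin 4 → ℝ =>
        (C (q 0 + q 1 * x) + C (q 2 + q 3 * x) * X : ℝ[X])) '' S, f.eval y = 0}) := by
    refine SmoothlyParametrized.biUnion hfin fun x _ => ?_
    exact ((SmoothlyParametrized.polynomial_zeros _).image_of_contDiff
      (contDiff_const.prodMk contDiff_id)).of_surjective
      (ContinuousLinearMap.fst ℝ ℝ ℝ) Prod.fst_surjective
  convert h1.union h2 using 1
  ext ⟨x, y⟩
  simp only [T, Set.mem_ofPred_eq, Set.mem_union, Set.mem_image, Set.mem_inter_iff, Prod.mk.injEq,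
    Set.mem_iUnion, biaffine, forall_exists_index, and_imp, forall_apply_eq_imp_iff₂, eval_sub,
    eval_add, eval_mul, eval_C, eval_X, hlx, hrx]
  constructor
  · intro hz
    have hpz := hz p hp
    by_cases hlz : p 2 + p 3 * x = 0
    · refine Or.inr ⟨x, ⟨hlz, by linear_combination hpz - y * hlz⟩, y, fun q hq => ?_, rfl, rfl⟩
      linear_combination hz q hq
    · refine Or.inl ⟨x, ⟨fun q hq => ?_, hlz⟩, rfl, ?_⟩
      · linear_combination (p 2 + p 3 * x) * hz q hq - (q 2 + q 3 * x) * hpz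
      · rw [div_eq_iff hlz]
        linear_combination -hpz
  · rintro (⟨x', ⟨hz, hlz⟩, rfl, rfl⟩ | ⟨x', -, y', hz, rfl, rfl⟩) q hq
    · have hy := div_mul_cancel₀ (-(p 0 + p 1 * x')) hlz
      generalize -(p 0 + p 1 * x') / (p 2 + p 3 * x') = y at hy ⊢
      apply mul_left_cancel₀ hlz
      linear_combination hz q hq + (q 2 + q 3 * x') * hy
    · linear_combination hz q hq

/-! ### Equations of lines on the hypersurface -/

/-- The value of the reliability polynomial at the first five coordinates of `x`. -/
def bridgeValue (x : Fin 6 → ℝ) : ℝ :=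
  x 0 * x 3 + x 1 * x 4 + x 1 * x 2 * x 3 - x 0 * x 1 * x 2 * x 3 - x 0 * x 1 * x 3 * x 4
    - x 1 * x 2 * x 3 * x 4 + x 0 * x 1 * x 2 * x 3 * x 4

theorem mem_reliabilityHypersurface (x : Fin 6 → ℝ) :
    x ∈ reliabilityHypersurface ↔ x 5 = bridgeValue x := by
  simp [reliabilityHypersurface, bridgePolynomial, bridgeValue]

theorem lineSet_subset_iff {n : ℕ} {a b : Fin n → ℝ} {S : Set (Fin n → ℝ)} :
    lineSet a b ⊆ S ↔ ∀ t : ℝ, t • a + b ∈ S :=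
  Set.range_subset_iff

/-- If the `k`-th component of the direction does not vanish, the line can be parametrized by its
`k`-th coordinate. -/
theorem lineSet_normalize {n : ℕ} (a b : Fin n → ℝ) {k : Fin n} (hk : a k ≠ 0) :
    lineSet ((a k)⁻¹ • a) (b - (b k / a k) • a) = lineSet a b := by
  ext x
  constructor
  · rintro ⟨t, rfl⟩
    refine ⟨t * (a k)⁻¹ - b k / a k, ?_⟩
    ext i
    simp
    ring
  · rintro ⟨t, rfl⟩
    refine ⟨t * a k + b k, ?_⟩
    ext i
    simp
    field_simp
    ring

theorem quintic_coeff_eq_zero {c₀ c₁ c₂ c₃ c₄ c₅ : ℝ}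
    (h : ∀ t : ℝ, c₀ + c₁ * t + c₂ * t ^ 2 + c₃ * t ^ 3 + c₄ * t ^ 4 + c₅ * t ^ 5 = 0) :
    c₀ = 0 ∧ c₁ = 0 ∧ c₂ = 0 ∧ c₃ = 0 ∧ c₄ = 0 ∧ c₅ = 0 := by
  have h0 := h 0
  have h1 := h 1
  have h2 := h (-1)
  have h3 := h 2
  have h4 := h (-2)
  have h5 := h 3
  norm_num at h0 h1 h2 h3 h4 h5
  refine ⟨?_, ?_, ?_, ?_, ?_, ?_⟩ <;> linarith

/-- Pairs `(a, b)` such that `t a + b` describes a straight line contained in the hypersurface. -/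
def lineData : Set ((Fin 6 → ℝ) × (Fin 6 → ℝ)) :=
  {p | p.1 ≠ 0 ∧ lineSet p.1 p.2 ⊆ reliabilityHypersurface}

/-- The space of six parameters, grouped as two fixed coordinates of the lines and four other
parameters. -/
abbrev Params : Type := (ℝ × ℝ) × ℝ × ℝ × ℝ × ℝ

/-- The conditions on `((x, y), α, β, γ, δ)` for the restriction of
`A u v w + B u v + C u w + D v w` to the line `u = t`, `v = α t + γ`, `w = β t + δ`
to have degree at most one in `t`; the coefficients are biaffine functions of `(x, y)`. -/
def cubicConditions (A B C D : Fin 4 → ℝ) : Set Params :=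
  {v | biaffine A v.1 * v.2.1 * v.2.2.1 = 0 ∧
    biaffine A v.1 * (v.2.2.2.1 * v.2.2.1 + v.2.2.2.2 * v.2.1) + biaffine B v.1 * v.2.1
      + biaffine C v.1 * v.2.2.1 + biaffine D v.1 * v.2.1 * v.2.2.1 = 0}

/-- Case by case, one of α, β, γ, δ is solved for as a quotient, unless the equations already hold
identically. Closed conditions on (x, y) are handled by `biaffine_zeros`, nonvanishing of
denominators is open. -/
theorem SmoothlyParametrized.cubicConditions (A B C D : Fin 4 → ℝ) :
    SmoothlyParametrized Params (cubicConditions A B C D) := by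
  have cA := contDiff_biaffine A
  have cB := contDiff_biaffine B
  have cC := contDiff_biaffine C
  have cD := contDiff_biaffine D
  have pieces : ∀ (S : Set (Fin 4 → ℝ)) (d : Params → ℝ) (g : Params → Params),
      ContDiff ℝ ∞ d → ContDiffOn ℝ ∞ g {v | d v ≠ 0} →
      SmoothlyParametrized Params (g '' ({z : ℝ × ℝ | ∀ q ∈ S, biaffine q z = 0} ×ˢ
        (Set.univ : Set (ℝ × ℝ × ℝ × ℝ)) ∩ {v | d v ≠ 0})) := fun S d g hd hg =>
    (SmoothlyParametrized.biaffine_zeros S).prod_univ.image_inter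
      (isOpen_ne_fun hd.continuous continuous_const) hg
  -- If A ≠ 0, then αβ = 0: `p₁` has α = 0 and γ = -C/A, `p₂` has β = 0 and δ = -B/A, and `p₃` has α
  -- = β = 0.
  have p₁ := pieces ∅ (fun v => biaffine A v.1)
    (fun v => (v.1, 0, v.2.2.1, -biaffine C v.1 / biaffine A v.1, v.2.2.2.2)) (by fun_prop)
    (by fun_prop (disch := exact fun _ h => h))
  have p₂ := pieces ∅ (fun v => biaffine A v.1)
    (fun v => (v.1, v.2.1, 0, v.2.2.2.1, -biaffine B v.1 / biaffine A v.1)) (by fun_prop)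
    (by fun_prop (disch := exact fun _ h => h))
  have p₃ := pieces ∅ (fun _ => 1) (fun v => (v.1, 0, 0, v.2.2.2)) (by fun_prop) (by fun_prop)
  -- If A = 0, what remains is α(B + Dβ) = -Cβ. `p₄` solves it for α; in `p₅`, `p₆`, `p₇` one has B
  -- + Dβ = 0 and Cβ = 0.
  have p₄ := pieces {A} (fun v => biaffine B v.1 + biaffine D v.1 * v.2.2.1)
    (fun v => (v.1, -biaffine C v.1 * v.2.2.1 / (biaffine B v.1 + biaffine D v.1 * v.2.2.1),
      v.2.2)) (by fun_prop) (by fun_prop (disch := exact fun _ h => h))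
  have p₅ := pieces {A, B} (fun _ => 1) (fun v => (v.1, v.2.1, 0, v.2.2.2)) (by fun_prop)
    (by fun_prop)
  have p₆ := pieces {A, C} (fun v => biaffine D v.1)
    (fun v => (v.1, v.2.1, -biaffine B v.1 / biaffine D v.1, v.2.2.2)) (by fun_prop)
    (by fun_prop (disch := exact fun _ h => h))
  have p₇ := pieces {A, B, C, D} (fun _ => 1) id (by fun_prop) (by fun_prop)
  convert p₁.union <| p₂.union <| p₃.union <| p₄.union <| p₅.union <| p₆.union p₇ using 1
  apply Set.Subset.antisymm
  · rintro ⟨z, α, β, γ, δ⟩ ⟨h₁, h₂⟩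
    dsimp only at h₁ h₂
    by_cases hA : biaffine A z = 0
    · simp only [hA, zero_mul, zero_add] at h₂
      by_cases hd : biaffine B z + biaffine D z * β = 0
      · have hCβ : biaffine C z * β = 0 := by linear_combination h₂ - α * hd
        rcases mul_eq_zero.1 hCβ with hC | rfl
        · by_cases hD : biaffine D z = 0
          · have hB : biaffine B z = 0 := by simpa [hD] using hd
            iterate 6 apply Or.inr
            exact ⟨(z, α, β, γ, δ), by simp [hA, hB, hC, hD], rfl⟩
          · iterate 5 apply Or.inr
            refine Or.inl ⟨(z, α, β, γ, δ), by simp [hA, hC, hD], ?_⟩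
            have : -biaffine B z / biaffine D z = β := by
              rw [div_eq_iff hD]
              linear_combination -hd
            simp [this]
        · have hB : biaffine B z = 0 := by simpa using hd
          iterate 4 apply Or.inr
          exact Or.inl ⟨(z, α, 0, γ, δ), by simp [hA, hB], rfl⟩
      · iterate 3 apply Or.inr
        refine Or.inl ⟨(z, α, β, γ, δ), by simp [hA, hd], ?_⟩
        have : -biaffine C z * β / (biaffine B z + biaffine D z * β) = α := by
          rw [div_eq_iff hd]
          linear_combination -h₂
        simp only [this]
    · have h : α = 0 ∨ β = 0 := by simpa [hA] using h₁
      rcases h with rfl | rfl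
      · by_cases hβ : β = 0
        · subst hβ
          iterate 2 apply Or.inr
          exact Or.inl ⟨(z, 0, 0, γ, δ), by simp, rfl⟩
        · refine Or.inl ⟨(z, 0, β, γ, δ), by simp [hA], ?_⟩
          have : -biaffine C z / biaffine A z = γ := by
            rw [div_eq_iff hA]
            apply mul_left_cancel₀ hβ
            linear_combination -h₂
          simp only [this]
      · by_cases hα : α = 0
        · subst hα
          iterate 2 apply Or.inr
          exact Or.inl ⟨(z, 0, 0, γ, δ), by simp, rfl⟩
        · refine Or.inr (Or.inl ⟨(z, α, 0, γ, δ), by simp [hA], ?_⟩)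
          have : -biaffine B z / biaffine A z = δ := by
            rw [div_eq_iff hA]
            apply mul_left_cancel₀ hα
            linear_combination -h₂
          simp only [this]
  · rintro _ (⟨⟨z, α, β, γ, δ⟩, h, rfl⟩ | ⟨⟨z, α, β, γ, δ⟩, h, rfl⟩ | ⟨⟨z, α, β, γ, δ⟩, h, rfl⟩ |
      ⟨⟨z, α, β, γ, δ⟩, h, rfl⟩ | ⟨⟨z, α, β, γ, δ⟩, h, rfl⟩ | ⟨⟨z, α, β, γ, δ⟩, h, rfl⟩ |
      ⟨⟨z, α, β, γ, δ⟩, h, rfl⟩) <;> simp at h <;>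
      simp only [_root_.cubicConditions, Set.mem_ofPred_eq, id]
    · constructor
      · ring
      · field_simp
        ring
    · constructor
      · ring
      · field_simp
        ring
    · constructor <;> ring
    · obtain ⟨hA, hd⟩ := h
      rw [hA]
      refine ⟨by ring, ?_⟩
      linear_combination div_mul_cancel₀ (-biaffine C z * β) hd
    · obtain ⟨hA, hB⟩ := h
      rw [hA, hB]
      constructor <;> ring
    · obtain ⟨⟨hA, hC⟩, hD⟩ := h
      rw [hA, hC]
      refine ⟨by ring, ?_⟩
      field_simp
      ring
    · obtain ⟨hA, hB, hC, hD⟩ := h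
      rw [hA, hB, hC, hD]
      constructor <;> ring

/-! ### Lines with two constant coordinates -/

/-- Finitely many smooth families of lines in the hypersurface contain all lines in the
hypersurface that have an equation `t a + b` with `p a b`. -/
def CoveredLines (p : (Fin 6 → ℝ) → (Fin 6 → ℝ) → Prop) : Prop :=
  ∃ S ⊆ lineData, SmoothlyParametrized Params S ∧
    ∀ a b, (a, b) ∈ lineData → p a b → lineSet a b ∈ (fun q => lineSet q.1 q.2) '' S

theorem CoveredLines.or {p q : (Fin 6 → ℝ) → (Fin 6 → ℝ) → Prop} (hp : CoveredLines p)
    (hq : CoveredLines q) : CoveredLines fun a b => p a b ∨ q a b := by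
  obtain ⟨S, hS, hSp, hSc⟩ := hp
  obtain ⟨T, hT, hTp, hTc⟩ := hq
  refine ⟨S ∪ T, Set.union_subset hS hT, hSp.union hTp, fun a b hab h => ?_⟩
  rw [Set.image_union]
  exact h.imp (hSc a b hab) (hTc a b hab)

theorem CoveredLines.mono {p q : (Fin 6 → ℝ) → (Fin 6 → ℝ) → Prop} (hq : CoveredLines q)
    (h : ∀ a b, (a, b) ∈ lineData → p a b → q a b) : CoveredLines p := by
  obtain ⟨S, hS, hSp, hSc⟩ := hq
  exact ⟨S, hS, hSp, fun a b hab hp => hSc a b hab (h a b hab hp)⟩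

/-- It suffices to cover the lines whose equation is normalized by `a k = 1` and `b k = 0`. -/
theorem CoveredLines.of_normalized {p : (Fin 6 → ℝ) → (Fin 6 → ℝ) → Prop} (k : Fin 6)
    (h : CoveredLines fun a b => a k = 1 ∧ b k = 0 ∧ p a b)
    (hp : ∀ a b, a k ≠ 0 → p a b → p ((a k)⁻¹ • a) (b - (b k / a k) • a)) :
    CoveredLines fun a b => a k ≠ 0 ∧ p a b := by
  obtain ⟨S, hS, hSp, hSc⟩ := h
  refine ⟨S, hS, hSp, fun a b hab ⟨hk, hpab⟩ => ?_⟩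
  have hn := lineSet_normalize a b hk
  rw [← hn]
  refine hSc _ _ ⟨?_, ?_⟩ ⟨?_, ?_, hp a b hk hpab⟩
  · exact smul_ne_zero (inv_ne_zero hk) hab.1
  · exact hn.subset.trans hab.2
  · simp [hk]
  · simp [hk]

theorem coveredLines_of_normalized_two_fixed {k l m i j : Fin 6}
    (hnd : [k, l, m, i, j, 5].Nodup) (hmem : ∀ n, n ∈ [k, l, m, i, j, 5])
    (A B C D K L M N : Fin 4 → ℝ)
    (hP : ∀ x : Fin 6 → ℝ, bridgeValue x = biaffine A (x i, x j) * (x k * x l * x m)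
      + biaffine B (x i, x j) * (x k * x l) + biaffine C (x i, x j) * (x k * x m)
      + biaffine D (x i, x j) * (x l * x m) + biaffine K (x i, x j) * x k
      + biaffine L (x i, x j) * x l + biaffine M (x i, x j) * x m + biaffine N (x i, x j)) :
    CoveredLines fun a b => a k = 1 ∧ b k = 0 ∧ a i = 0 ∧ a j = 0 := by
  have cA := contDiff_biaffine A
  have cB := contDiff_biaffine B
  have cC := contDiff_biaffine C
  have cD := contDiff_biaffine D
  have cK := contDiff_biaffine K
  have cL := contDiff_biaffine L
  have cM := contDiff_biaffine M
  have cN := contDiff_biaffine N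
  simp only [List.nodup_cons, List.mem_cons, List.not_mem_nil, or_false, not_or,
    not_false_eq_true, List.nodup_nil, and_true] at hnd hmem
  obtain ⟨⟨hkl, hkm, hki, hkj, hk5⟩, ⟨hlm, hli, hlj, hl5⟩, ⟨hmi, hmj, hm5⟩, ⟨hij, hi5⟩, hj5⟩ := hnd
  -- `a₅` and `b₅` are the coefficients of t and 1 in P along the line; the coefficients of t³ and
  -- t² give `cubicConditions`.
  let a₅ : Params → ℝ := fun v =>
    biaffine A v.1 * (v.2.2.2.1 * v.2.2.2.2) + biaffine B v.1 * v.2.2.2.1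
      + biaffine C v.1 * v.2.2.2.2 + biaffine D v.1 * (v.2.1 * v.2.2.2.2 + v.2.2.1 * v.2.2.2.1)
      + biaffine K v.1 + biaffine L v.1 * v.2.1 + biaffine M v.1 * v.2.2.1
  let b₅ : Params → ℝ := fun v =>
    biaffine D v.1 * (v.2.2.2.1 * v.2.2.2.2) + biaffine L v.1 * v.2.2.2.1
      + biaffine M v.1 * v.2.2.2.2 + biaffine N v.1
  let a : Params → Fin 6 → ℝ := fun v n =>
    if n = k then 1 else if n = l then v.2.1 else if n = m then v.2.2.1 else if n = i then 0
    else if n = j then 0 else a₅ v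
  let b : Params → Fin 6 → ℝ := fun v n =>
    if n = k then 0 else if n = l then v.2.2.2.1 else if n = m then v.2.2.2.2
    else if n = i then v.1.1 else if n = j then v.1.2 else b₅ v
  have hak : ∀ v, a v k = 1 := fun v => by simp [a]
  have hal : ∀ v, a v l = v.2.1 := fun v => by simp [a, Ne.symm hkl]
  have ham : ∀ v, a v m = v.2.2.1 := fun v => by simp [a, Ne.symm hkm, Ne.symm hlm]
  have hai : ∀ v, a v i = 0 := fun v => by simp [a, Ne.symm hki, Ne.symm hli, Ne.symm hmi]
  have haj : ∀ v, a v j = 0 := fun v => by simp [a, Ne.symm hkj, Ne.symm hlj, Ne.symm hmj]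
  have ha5 : ∀ v, a v 5 = a₅ v := fun v => by
    simp [a, Ne.symm hk5, Ne.symm hl5, Ne.symm hm5, Ne.symm hi5, Ne.symm hj5]
  have hbk : ∀ v, b v k = 0 := fun v => by simp [b]
  have hbl : ∀ v, b v l = v.2.2.2.1 := fun v => by simp [b, Ne.symm hkl]
  have hbm : ∀ v, b v m = v.2.2.2.2 := fun v => by simp [b, Ne.symm hkm, Ne.symm hlm]
  have hbi : ∀ v, b v i = v.1.1 := fun v => by simp [b, Ne.symm hki, Ne.symm hli, Ne.symm hmi]
  have hbj : ∀ v, b v j = v.1.2 := fun v => by simp [b, Ne.symm hkj, Ne.symm hlj, Ne.symm hmj, Ne.symm hij]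
  have hb5 : ∀ v, b v 5 = b₅ v := fun v => by
    simp [b, Ne.symm hk5, Ne.symm hl5, Ne.symm hm5, Ne.symm hi5, Ne.symm hj5]
  have hac : ContDiff ℝ ∞ a := by
    refine contDiff_pi.2 fun n => ?_
    rcases hmem n with rfl | rfl | rfl | rfl | rfl | rfl <;> simp only [*] <;> fun_prop
  have hbc : ContDiff ℝ ∞ b := by
    refine contDiff_pi.2 fun n => ?_
    rcases hmem n with rfl | rfl | rfl | rfl | rfl | rfl <;> simp only [*] <;> fun_prop
  clear_value a b
  refine ⟨(fun v => (a v, b v)) '' cubicConditions A B C D, ?_,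
    (SmoothlyParametrized.cubicConditions A B C D).image_of_contDiff (hac.prodMk hbc), ?_⟩
  · rintro _ ⟨⟨z, α, β, γ, δ⟩, ⟨h₁, h₂⟩, rfl⟩
    refine ⟨fun h => ?_, lineSet_subset_iff.2 fun t => ?_⟩
    · simpa [hak] using congrFun h k
    · rw [mem_reliabilityHypersurface, hP]
      simp only [Pi.add_apply, Pi.smul_apply, smul_eq_mul, hak, hal, ham, hai, haj, ha5, hbk, hbl,
        hbm, hbi, hbj, hb5, mul_zero, zero_add, a₅, b₅]
      dsimp only at h₁ h₂
      linear_combination -t ^ 3 * h₁ - t ^ 2 * h₂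
  · rintro a' b' ⟨-, hab⟩ ⟨hak', hbk', hai', haj'⟩
    rw [lineSet_subset_iff] at hab
    simp only [mem_reliabilityHypersurface, hP, Pi.add_apply, Pi.smul_apply, smul_eq_mul, hak',
      hbk', hai', haj', mul_zero, zero_add] at hab
    let v : Params := ((b' i, b' j), a' l, a' m, b' l, b' m)
    obtain ⟨c₀, c₁, c₂, c₃, -, -⟩ := quintic_coeff_eq_zero (c₀ := b₅ v - b' 5)
      (c₁ := a₅ v - a' 5)
      (c₂ := biaffine A v.1 * (v.2.2.2.1 * v.2.2.1 + v.2.2.2.2 * v.2.1) + biaffine B v.1 * v.2.1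
        + biaffine C v.1 * v.2.2.1 + biaffine D v.1 * v.2.1 * v.2.2.1)
      (c₃ := biaffine A v.1 * v.2.1 * v.2.2.1) (c₄ := 0) (c₅ := 0)
      (fun t => by
        simp only [a₅, b₅, v]
        linear_combination -hab t)
    refine ⟨_, ⟨v, ⟨c₃, c₂⟩, rfl⟩, ?_⟩
    have ea : a v = a' := by
      ext n
      rcases hmem n with rfl | rfl | rfl | rfl | rfl | rfl
      · rw [hak, hak']
      · rw [hal]
      · rw [ham]
      · rw [hai, hai']
      · rw [haj, haj']
      · rw [ha5]
        exact sub_eq_zero.1 c₁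
    have eb : b v = b' := by
      ext n
      rcases hmem n with rfl | rfl | rfl | rfl | rfl | rfl
      · rw [hbk, hbk']
      · rw [hbl]
      · rw [hbm]
      · rw [hbi]
      · rw [hbj]
      · rw [hb5]
        exact sub_eq_zero.1 c₀
    simp only [ea, eb]

/-- One of the three remaining coordinates must move and can serve as line parameter; permuting k,
l, m permutes B, C, D and K, L, M. -/
theorem coveredLines_of_two_fixed {k l m i j : Fin 6}
    (hnd : [k, l, m, i, j, 5].Nodup) (hmem : ∀ n, n ∈ [k, l, m, i, j, 5])
    (A B C D K L M N : Fin 4 → ℝ)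
    (hP : ∀ x : Fin 6 → ℝ, bridgeValue x = biaffine A (x i, x j) * (x k * x l * x m)
      + biaffine B (x i, x j) * (x k * x l) + biaffine C (x i, x j) * (x k * x m)
      + biaffine D (x i, x j) * (x l * x m) + biaffine K (x i, x j) * x k
      + biaffine L (x i, x j) * x l + biaffine M (x i, x j) * x m + biaffine N (x i, x j)) :
    CoveredLines fun a _ => a i = 0 ∧ a j = 0 := by
  have pl : List.Perm [k, l, m, i, j, 5] [l, k, m, i, j, 5] := .swap _ _ _
  have pm : List.Perm [k, l, m, i, j, 5] [m, k, l, i, j, 5] :=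
    ((List.Perm.swap m l _).cons k).trans (.swap _ _ _)
  have hk := coveredLines_of_normalized_two_fixed hnd hmem A B C D K L M N hP
  have hl := coveredLines_of_normalized_two_fixed (pl.nodup_iff.1 hnd)
    (fun n => pl.mem_iff.1 (hmem n)) A B D C L K M N fun x => by rw [hP]; ring
  have hm := coveredLines_of_normalized_two_fixed (pm.nodup_iff.1 hnd)
    (fun n => pm.mem_iff.1 (hmem n)) A C D B M K L N fun x => by rw [hP]; ring
  have scale : ∀ (n : Fin 6) (a _b : Fin 6 → ℝ), a n ≠ 0 → (a i = 0 ∧ a j = 0) →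
      (((a n)⁻¹ • a) i = 0 ∧ ((a n)⁻¹ • a) j = 0) := by
    rintro n a - - ⟨h, h'⟩
    simp [h, h']
  refine ((hk.of_normalized k (scale k)).or ((hl.of_normalized l (scale l)).or
    (hm.of_normalized m (scale m)))).mono fun a b hab h => ?_
  -- If none of the first five coordinates moved, P would be constant on the line, forcing `a 5 = 0`
  -- and hence `a = 0`.
  by_contra hcon
  have hak : a k = 0 := by_contra fun h' => hcon (Or.inl ⟨h', h⟩)
  have hal : a l = 0 := by_contra fun h' => hcon (Or.inr (Or.inl ⟨h', h⟩))
  have ham : a m = 0 := by_contra fun h' => hcon (Or.inr (Or.inr ⟨h', h⟩))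
  have hline := lineSet_subset_iff.1 hab.2
  simp only [mem_reliabilityHypersurface, hP, Pi.add_apply, Pi.smul_apply, smul_eq_mul, hak, hal,
    ham, h.1, h.2, mul_zero, zero_add] at hline
  have h0 := hline 0
  have h1 := hline 1
  refine hab.1 (funext fun n => ?_)
  have hn := hmem n
  simp only [List.mem_cons, List.not_mem_nil, or_false] at hn
  rcases hn with rfl | rfl | rfl | rfl | rfl | rfl
  exacts [hak, hal, ham, h.1, h.2, by simp only [Pi.zero_apply]; linarith]

/-- Each vector lists the coefficients of 1, xᵢ, xⱼ, xᵢxⱼ in one of A, B, C, D, K, L, M, N; likewise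
for the other nine pairs. -/
theorem coveredLines_fixed_3_4 : CoveredLines fun a _ => a 3 = 0 ∧ a 4 = 0 := by
  refine coveredLines_of_two_fixed (k := 0) (l := 1) (m := 2) (by decide) (by decide)
    ![0, -1, 0, 1] ![0, 0, 0, -1] ![0, 0, 0, 0] ![0, 1, 0, -1]
    ![0, 1, 0, 0] ![0, 0, 1, 0] ![0, 0, 0, 0] ![0, 0, 0, 0] fun x => ?_
  simp [bridgeValue, biaffine]
  ring

theorem coveredLines_fixed_2_4 : CoveredLines fun a _ => a 2 = 0 ∧ a 4 = 0 := by
  refine coveredLines_of_two_fixed (k := 0) (l := 1) (m := 3) (by decide) (by decide)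
    ![0, -1, -1, 1] ![0, 0, 0, 0] ![1, 0, 0, 0] ![0, 1, 0, -1]
    ![0, 0, 0, 0] ![0, 0, 1, 0] ![0, 0, 0, 0] ![0, 0, 0, 0] fun x => ?_
  simp [bridgeValue, biaffine]
  ring

theorem coveredLines_fixed_2_3 : CoveredLines fun a _ => a 2 = 0 ∧ a 3 = 0 := by
  refine coveredLines_of_two_fixed (k := 0) (l := 1) (m := 4) (by decide) (by decide)
    ![0, 0, -1, 1] ![0, 0, 0, -1] ![0, 0, 0, 0] ![1, 0, 0, -1]
    ![0, 0, 1, 0] ![0, 0, 0, 1] ![0, 0, 0, 0] ![0, 0, 0, 0] fun x => ?_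
  simp [bridgeValue, biaffine]
  ring

theorem coveredLines_fixed_1_4 : CoveredLines fun a _ => a 1 = 0 ∧ a 4 = 0 := by
  refine coveredLines_of_two_fixed (k := 0) (l := 2) (m := 3) (by decide) (by decide)
    ![0, -1, 0, 1] ![0, 0, 0, 0] ![1, 0, 0, -1] ![0, 1, 0, -1]
    ![0, 0, 0, 0] ![0, 0, 0, 0] ![0, 0, 0, 0] ![0, 0, 0, 1] fun x => ?_
  simp [bridgeValue, biaffine]
  ring

theorem coveredLines_fixed_1_3 : CoveredLines fun a _ => a 1 = 0 ∧ a 3 = 0 := by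
  refine coveredLines_of_two_fixed (k := 0) (l := 2) (m := 4) (by decide) (by decide)
    ![0, 0, 0, 1] ![0, 0, 0, -1] ![0, 0, 0, -1] ![0, 0, 0, -1]
    ![0, 0, 1, 0] ![0, 0, 0, 1] ![0, 1, 0, 0] ![0, 0, 0, 0] fun x => ?_
  simp [bridgeValue, biaffine]
  ring

theorem coveredLines_fixed_1_2 : CoveredLines fun a _ => a 1 = 0 ∧ a 2 = 0 := by
  refine coveredLines_of_two_fixed (k := 0) (l := 3) (m := 4) (by decide) (by decide)
    ![0, -1, 0, 1] ![1, 0, 0, -1] ![0, 0, 0, 0] ![0, 0, 0, -1]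
    ![0, 0, 0, 0] ![0, 0, 0, 1] ![0, 1, 0, 0] ![0, 0, 0, 0] fun x => ?_
  simp [bridgeValue, biaffine]
  ring

theorem coveredLines_fixed_0_4 : CoveredLines fun a _ => a 0 = 0 ∧ a 4 = 0 := by
  refine coveredLines_of_two_fixed (k := 1) (l := 2) (m := 3) (by decide) (by decide)
    ![1, -1, -1, 1] ![0, 0, 0, 0] ![0, 0, 0, -1] ![0, 0, 0, 0]
    ![0, 0, 1, 0] ![0, 0, 0, 0] ![0, 1, 0, 0] ![0, 0, 0, 0] fun x => ?_
  simp [bridgeValue, biaffine]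
  ring

theorem coveredLines_fixed_0_3 : CoveredLines fun a _ => a 0 = 0 ∧ a 3 = 0 := by
  refine coveredLines_of_two_fixed (k := 1) (l := 2) (m := 4) (by decide) (by decide)
    ![0, 0, -1, 1] ![0, 0, 1, -1] ![1, 0, 0, -1] ![0, 0, 0, 0]
    ![0, 0, 0, 0] ![0, 0, 0, 0] ![0, 0, 0, 0] ![0, 0, 0, 1] fun x => ?_
  simp [bridgeValue, biaffine]
  ring

theorem coveredLines_fixed_0_2 : CoveredLines fun a _ => a 0 = 0 ∧ a 2 = 0 := by
  refine coveredLines_of_two_fixed (k := 1) (l := 3) (m := 4) (by decide) (by decide)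
    ![0, -1, -1, 1] ![0, 0, 1, -1] ![1, 0, 0, 0] ![0, 0, 0, 0]
    ![0, 0, 0, 0] ![0, 1, 0, 0] ![0, 0, 0, 0] ![0, 0, 0, 0] fun x => ?_
  simp [bridgeValue, biaffine]
  ring

theorem coveredLines_fixed_0_1 : CoveredLines fun a _ => a 0 = 0 ∧ a 1 = 0 := by
  refine coveredLines_of_two_fixed (k := 2) (l := 3) (m := 4) (by decide) (by decide)
    ![0, 0, -1, 1] ![0, 0, 1, -1] ![0, 0, 0, 0] ![0, 0, 0, -1]
    ![0, 0, 0, 0] ![0, 1, 0, 0] ![0, 0, 1, 0] ![0, 0, 0, 0] fun x => ?_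
  simp [bridgeValue, biaffine]
  ring

/-! ### Which coordinates are constant -/

/-- The vanishing of the coefficients of degree `2, 3, 4, 5` in the equation of a line in the
hypersurface. -/
theorem coeff_eq_zero_of_lineSet_subset {a b : Fin 6 → ℝ}
    (h : lineSet a b ⊆ reliabilityHypersurface) :
    (a 0 * a 3 + a 1 * a 4 + (a 1 * a 2 * b 3 + a 1 * b 2 * a 3 + b 1 * a 2 * a 3) -
      (a 0 * a 1 * b 2 * b 3 + a 0 * b 1 * a 2 * b 3 + a 0 * b 1 * b 2 * a 3 +
      b 0 * a 1 * a 2 * b 3 + b 0 * a 1 * b 2 * a 3 + b 0 * b 1 * a 2 * a 3) -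
      (a 0 * a 1 * b 3 * b 4 + a 0 * b 1 * a 3 * b 4 + a 0 * b 1 * b 3 * a 4 +
      b 0 * a 1 * a 3 * b 4 + b 0 * a 1 * b 3 * a 4 + b 0 * b 1 * a 3 * a 4) -
      (a 1 * a 2 * b 3 * b 4 + a 1 * b 2 * a 3 * b 4 + a 1 * b 2 * b 3 * a 4 +
      b 1 * a 2 * a 3 * b 4 + b 1 * a 2 * b 3 * a 4 + b 1 * b 2 * a 3 * a 4) +
      (a 0 * a 1 * b 2 * b 3 * b 4 + a 0 * b 1 * a 2 * b 3 * b 4 + a 0 * b 1 * b 2 * a 3 * b 4 +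
      a 0 * b 1 * b 2 * b 3 * a 4 + b 0 * a 1 * a 2 * b 3 * b 4 + b 0 * a 1 * b 2 * a 3 * b 4 +
      b 0 * a 1 * b 2 * b 3 * a 4 + b 0 * b 1 * a 2 * a 3 * b 4 + b 0 * b 1 * a 2 * b 3 * a 4 +
      b 0 * b 1 * b 2 * a 3 * a 4) = 0) ∧
    (a 1 * a 2 * a 3 - (a 0 * a 1 * a 2 * b 3 + a 0 * a 1 * b 2 * a 3 + a 0 * b 1 * a 2 * a 3 +
      b 0 * a 1 * a 2 * a 3) - (a 0 * a 1 * a 3 * b 4 + a 0 * a 1 * b 3 * a 4 +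
      a 0 * b 1 * a 3 * a 4 + b 0 * a 1 * a 3 * a 4) - (a 1 * a 2 * a 3 * b 4 +
      a 1 * a 2 * b 3 * a 4 + a 1 * b 2 * a 3 * a 4 + b 1 * a 2 * a 3 * a 4) +
      (a 0 * a 1 * a 2 * b 3 * b 4 + a 0 * a 1 * b 2 * a 3 * b 4 + a 0 * a 1 * b 2 * b 3 * a 4 +
      a 0 * b 1 * a 2 * a 3 * b 4 + a 0 * b 1 * a 2 * b 3 * a 4 + a 0 * b 1 * b 2 * a 3 * a 4 +
      b 0 * a 1 * a 2 * a 3 * b 4 + b 0 * a 1 * a 2 * b 3 * a 4 + b 0 * a 1 * b 2 * a 3 * a 4 +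
      b 0 * b 1 * a 2 * a 3 * a 4) = 0) ∧
    (-a 0 * a 1 * a 2 * a 3 - a 0 * a 1 * a 3 * a 4 - a 1 * a 2 * a 3 * a 4 +
      (a 0 * a 1 * a 2 * a 3 * b 4 + a 0 * a 1 * a 2 * b 3 * a 4 + a 0 * a 1 * b 2 * a 3 * a 4 +
      a 0 * b 1 * a 2 * a 3 * a 4 + b 0 * a 1 * a 2 * a 3 * a 4) = 0) ∧
    (a 0 * a 1 * a 2 * a 3 * a 4 = 0) := by
  have hab := lineSet_subset_iff.1 h
  simp only [mem_reliabilityHypersurface, bridgeValue, Pi.add_apply, Pi.smul_apply,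
    smul_eq_mul] at hab
  -- The coefficients of degree 0 and 1 only determine `b 5` and `a 5`, so their vanishing is
  -- discarded.
  refine (quintic_coeff_eq_zero
    (c₀ := b 0 * b 3 + b 1 * b 4 + b 1 * b 2 * b 3 - b 0 * b 1 * b 2 * b 3 - b 0 * b 1 * b 3 * b 4
      - b 1 * b 2 * b 3 * b 4 + b 0 * b 1 * b 2 * b 3 * b 4 - b 5)
    (c₁ := (a 0 * b 3 + b 0 * a 3) + (a 1 * b 4 + b 1 * a 4) + (a 1 * b 2 * b 3 + b 1 * a 2 * b 3
      + b 1 * b 2 * a 3) - (a 0 * b 1 * b 2 * b 3 + b 0 * a 1 * b 2 * b 3 + b 0 * b 1 * a 2 * b 3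
      + b 0 * b 1 * b 2 * a 3) - (a 0 * b 1 * b 3 * b 4 + b 0 * a 1 * b 3 * b 4 +
      b 0 * b 1 * a 3 * b 4 + b 0 * b 1 * b 3 * a 4) - (a 1 * b 2 * b 3 * b 4 +
      b 1 * a 2 * b 3 * b 4 + b 1 * b 2 * a 3 * b 4 + b 1 * b 2 * b 3 * a 4) +
      (a 0 * b 1 * b 2 * b 3 * b 4 + b 0 * a 1 * b 2 * b 3 * b 4 + b 0 * b 1 * a 2 * b 3 * b 4 +
      b 0 * b 1 * b 2 * a 3 * b 4 + b 0 * b 1 * b 2 * b 3 * a 4) - a 5)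
    fun t => ?_).2.2
  linear_combination -hab t

/-- If exactly one coordinate is constant, the coefficient of t⁴ fixes its value at 0 or 1 (a
deleted or contracted edge). P becomes x₃ + x₁x₄ - x₁x₃x₄ for x₀ = 1, x₀x₃ for x₁ = 0, x₁x₄ for x₃ =
0, and x₁ + x₀x₃ - x₀x₁x₃ for x₄ = 1. Each has a nonzero top coefficient in degree 2 or 3 along the
line, so only x₂ can be the constant coordinate. -/
theorem two_fixed_or_third_fixed {a b : Fin 6 → ℝ} (h : lineSet a b ⊆ reliabilityHypersurface) :
    (a 0 = 0 ∧ a 1 = 0 ∨ a 0 = 0 ∧ a 2 = 0 ∨ a 0 = 0 ∧ a 3 = 0 ∨ a 0 = 0 ∧ a 4 = 0 ∨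
      a 1 = 0 ∧ a 2 = 0 ∨ a 1 = 0 ∧ a 3 = 0 ∨ a 1 = 0 ∧ a 4 = 0 ∨ a 2 = 0 ∧ a 3 = 0 ∨
      a 2 = 0 ∧ a 4 = 0 ∨ a 3 = 0 ∧ a 4 = 0) ∨
    a 0 ≠ 0 ∧ a 2 = 0 ∧ a 1 ≠ 0 ∧ a 3 ≠ 0 ∧ a 4 ≠ 0 := by
  obtain ⟨c₂, c₃, c₄, c₅⟩ := coeff_eq_zero_of_lineSet_subset h
  by_cases h0 : a 0 = 0
  · by_cases h1 : a 1 = 0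
    · exact Or.inl (by simp [h0, h1])
    by_cases h2 : a 2 = 0
    · exact Or.inl (by simp [h0, h2])
    by_cases h3 : a 3 = 0
    · exact Or.inl (by simp [h0, h3])
    by_cases h4 : a 4 = 0
    · exact Or.inl (by simp [h0, h4])
    exfalso
    have hb : b 0 = 1 := by
      have : (a 1 * a 2 * a 3 * a 4) * (b 0 - 1) = 0 := by
        rw [h0] at c₄
        linear_combination c₄
      simpa [h1, h2, h3, h4, sub_eq_zero] using this
    have : a 1 * a 3 * a 4 = 0 := by
      rw [h0, hb] at c₃
      linear_combination -c₃
    simp [h1, h3, h4] at this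
  by_cases h1 : a 1 = 0
  · by_cases h2 : a 2 = 0
    · exact Or.inl (by simp [h1, h2])
    by_cases h3 : a 3 = 0
    · exact Or.inl (by simp [h1, h3])
    by_cases h4 : a 4 = 0
    · exact Or.inl (by simp [h1, h4])
    exfalso
    have hb : b 1 = 0 := by
      have : (a 0 * a 2 * a 3 * a 4) * b 1 = 0 := by
        rw [h1] at c₄
        linear_combination c₄
      simpa [h0, h2, h3, h4] using this
    have : a 0 * a 3 = 0 := by
      rw [h1, hb] at c₂
      linear_combination c₂
    simp [h0, h3] at this
  by_cases h3 : a 3 = 0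
  · by_cases h2 : a 2 = 0
    · exact Or.inl (by simp [h3, h2])
    by_cases h4 : a 4 = 0
    · exact Or.inl (by simp [h3, h4])
    exfalso
    have hb : b 3 = 0 := by
      have : (a 0 * a 1 * a 2 * a 4) * b 3 = 0 := by
        rw [h3] at c₄
        linear_combination c₄
      simpa [h0, h1, h2, h4] using this
    have : a 1 * a 4 = 0 := by
      rw [h3, hb] at c₂
      linear_combination c₂
    simp [h1, h4] at this
  by_cases h4 : a 4 = 0
  · by_cases h2 : a 2 = 0
    · exact Or.inl (by simp [h4, h2])
    exfalso
    have hb : b 4 = 1 := by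
      have : (a 0 * a 1 * a 2 * a 3) * (b 4 - 1) = 0 := by
        rw [h4] at c₄
        linear_combination c₄
      simpa [h0, h1, h2, h3, sub_eq_zero] using this
    have : a 0 * a 1 * a 3 = 0 := by
      rw [h4, hb] at c₃
      linear_combination -c₃
    simp [h0, h1, h3] at this
  have h2 : a 2 = 0 := by simpa [h0, h1, h3, h4] using c₅
  exact Or.inr ⟨h0, h2, h1, h3, h4⟩

/-! ### Lines on which only x₂ is constant -/

/-- The coefficient of t⁴ forces x₂ = 1, where P = x₀x₃ + x₁x₄ + x₁x₃(1 - x₀ - x₄). The cubic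
coefficient then makes x₀ + x₄ a constant s, and the quadratic one determines s from a₁ and a₃. -/
theorem coveredLines_third_fixed :
    CoveredLines fun a _ => a 0 ≠ 0 ∧ a 2 = 0 ∧ a 1 ≠ 0 ∧ a 3 ≠ 0 ∧ a 4 ≠ 0 := by
  refine CoveredLines.of_normalized 0 ?_ ?_
  swap
  · rintro a - h0 ⟨h2, h1, h3, h4⟩
    simp [h0, h1, h2, h3, h4]
  -- Solution of a₃ - a₁ + a₁a₃(1 - s) = 0, the quadratic coefficient; s is the value of x₄ at x₀ =
  -- 0.
  let s : Params → ℝ := fun v => 1 + (v.2.2.1 - v.2.1) / (v.2.1 * v.2.2.1)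
  let a : Params → Fin 6 → ℝ := fun v => ![1, v.2.1, 0, v.2.2.1, -1,
    v.2.2.2.2 + v.2.1 * s v - v.2.2.2.1
      + (v.2.1 * v.2.2.2.2 + v.2.2.1 * v.2.2.2.1) * (1 - s v)]
  let b : Params → Fin 6 → ℝ := fun v => ![0, v.2.2.2.1, 1, v.2.2.2.2, s v,
    v.2.2.2.1 * s v + v.2.2.2.1 * v.2.2.2.2 * (1 - s v)]
  let U : Set Params := {v | v.2.1 * v.2.2.1 ≠ 0}
  have hU : IsOpen U := isOpen_ne_fun (by fun_prop) continuous_const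
  have hs : ContDiffOn ℝ ∞ s U := by
    have : ∀ v ∈ U, v.2.1 * v.2.2.1 ≠ 0 := fun v hv => hv
    fun_prop (disch := assumption)
  have ha : ContDiffOn ℝ ∞ a U := by
    refine contDiffOn_pi.2 fun n => ?_
    fin_cases n <;> simp [a] <;> fun_prop
  have hb : ContDiffOn ℝ ∞ b U := by
    refine contDiffOn_pi.2 fun n => ?_
    fin_cases n <;> simp [b] <;> fun_prop
  have hsv : ∀ v ∈ U, v.2.2.1 - v.2.1 + v.2.1 * v.2.2.1 * (1 - s v) = 0 := fun v hv => by
    linear_combination -div_mul_cancel₀ (v.2.2.1 - v.2.1) hv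
  refine ⟨(fun v => (a v, b v)) '' U, ?_, .image hU (ha.prodMk hb), ?_⟩
  · rintro _ ⟨v, hv, rfl⟩
    refine ⟨fun h => ?_, lineSet_subset_iff.2 fun t => ?_⟩
    · simpa [a] using congrFun h 0
    · rw [mem_reliabilityHypersurface]
      simp only [bridgeValue, a, b, Pi.add_apply, Pi.smul_apply, smul_eq_mul]
      simp
      linear_combination -t ^ 2 * hsv v hv
  · rintro a' b' ⟨-, hab⟩ ⟨h0, hb0, h2, h1, h3, h4⟩
    obtain ⟨c₂, c₃, c₄, -⟩ := coeff_eq_zero_of_lineSet_subset hab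
    simp only [h0, hb0, h2] at c₂ c₃ c₄
    have hb2 : b' 2 = 1 := by
      have : (a' 1 * a' 3 * a' 4) * (b' 2 - 1) = 0 := by linear_combination c₄
      simpa [h1, h3, h4, sub_eq_zero] using this
    simp only [hb2] at c₂ c₃
    have ha4 : a' 4 = -1 := by
      have : (a' 1 * a' 3) * (a' 4 + 1) = 0 := by linear_combination -c₃
      simpa [h1, h3, add_eq_zero_iff_eq_neg] using this
    simp only [ha4] at c₂
    -- The first component is a dummy: `a` and `b` do not depend on it.
    let v : Params := (0, a' 1, a' 3, b' 1, b' 3)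
    have hv : v ∈ U := mul_ne_zero h1 h3
    have hb4 : s v = b' 4 := by
      have := hsv v hv
      apply mul_left_cancel₀ hv
      linear_combination c₂ - this
    have hline := lineSet_subset_iff.1 hab
    simp only [mem_reliabilityHypersurface, bridgeValue, Pi.add_apply, Pi.smul_apply, smul_eq_mul,
      h0, hb0, h2, hb2, ha4] at hline
    have hb5 := hline 0
    have ha5 := hline 1
    refine ⟨_, ⟨v, hv, rfl⟩, ?_⟩
    have ea : a v = a' := by
      ext n
      fin_cases n <;> simp [a, hb4, h0, h2, ha4]
      all_goals simp only [v]
      linear_combination hb5 - ha5 - c₂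
    have eb : b v = b' := by
      ext n
      fin_cases n <;> simp [b, hb4, hb0, hb2]
      all_goals simp only [v]
      linear_combination -hb5
    simp only [ea, eb]

theorem coveredLines_all : CoveredLines fun _ _ => True := by
  refine ((coveredLines_fixed_0_1.or <| coveredLines_fixed_0_2.or <| coveredLines_fixed_0_3.or <|
    coveredLines_fixed_0_4.or <| coveredLines_fixed_1_2.or <| coveredLines_fixed_1_3.or <| coveredLines_fixed_1_4.or <|
    coveredLines_fixed_2_3.or <| coveredLines_fixed_2_4.or coveredLines_fixed_3_4).or
    coveredLines_third_fixed).mono fun a b hab _ => two_fixed_or_third_fixed hab.2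

theorem dependsOnAtMost_six : DependsOnAtMost (linesIn reliabilityHypersurface) 6 := by
  obtain ⟨S, hS, hSp, hSc⟩ := coveredLines_all
  let e : (Fin 6 → ℝ) ≃L[ℝ] Params := ContinuousLinearEquiv.ofFinrankEq (by simp)
  have h := (hSp.of_surjective (e : (Fin 6 → ℝ) →L[ℝ] Params) e.surjective).dependsOnAtMost
    fun p hp => (hS hp).1
  convert h using 1
  apply Set.Subset.antisymm
  · rintro _ ⟨⟨a, b, ha, rfl⟩, hL⟩
    exact hSc a b ⟨ha, hL⟩ trivial
  · rintro _ ⟨p, hp, rfl⟩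
    exact ⟨⟨p.1, p.2, (hS hp).1, rfl⟩, (hS hp).2⟩

/-! ### A family with five essential parameters -/

/-- The lines with `x₁ = 0` and constant `x₃` on which `x₀` is not constant. -/
theorem dependsOnAtLeast_five : DependsOnAtLeast (linesIn reliabilityHypersurface) 5 := by
  -- `u 0` is both the constant x₃ and the slope of x₅ = x₀x₃.
  let a : (Fin 5 → ℝ) → Fin 6 → ℝ := fun u => ![1, 0, u 1, 0, u 2, u 0]
  let b : (Fin 5 → ℝ) → Fin 6 → ℝ := fun u => ![0, 0, u 3, u 0, u 4, 0]
  have ha : ContDiff ℝ ∞ a := by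
    refine contDiff_pi.2 fun n => ?_
    fin_cases n <;> simp [a] <;> fun_prop
  have hb : ContDiff ℝ ∞ b := by
    refine contDiff_pi.2 fun n => ?_
    fin_cases n <;> simp [b] <;> fun_prop
  have ha0 : ∀ u, a u ≠ 0 := fun u h => by simpa [a] using congrFun h 0
  refine ⟨Set.univ, a, b, Set.univ_nonempty,
    ⟨isOpen_univ, ha.contDiffOn, hb.contDiffOn, fun u _ => ha0 u⟩, ⟨?_, ?_⟩, fun u _ => ?_⟩
  · intro u _ u' _ h
    dsimp only at h
    obtain ⟨t, ht⟩ : b u ∈ lineSet (a u') (b u') := h ▸ ⟨0, by simp⟩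
    obtain ⟨t', ht'⟩ : a u + b u ∈ lineSet (a u') (b u') := h ▸ ⟨1, by simp⟩
    -- Coordinate 0 is the line parameter, so equal lines agree at t = 0 and at t = 1.
    have t0 : t = 0 := by simpa [a, b] using congrFun ht 0
    have t1 : t' = 1 := by simpa [a, b] using congrFun ht' 0
    subst t0 t1
    have e3 := congrFun ht 2
    have e0 := congrFun ht 3
    have e4 := congrFun ht 4
    have e1 := congrFun ht' 2
    have e2 := congrFun ht' 4
    simp [a, b] at e0 e1 e2 e3 e4
    ext n
    fin_cases n <;> simp <;> linarith
  · intro u _ w hwa hwb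
    have dproj : ∀ i : Fin 5, fderiv ℝ (fun x : Fin 5 → ℝ => x i) u w = w i := fun i => by
      rw [(hasFDerivAt_apply i u).fderiv, ContinuousLinearMap.proj_apply]
    have da : fderiv ℝ a u w = ![0, 0, w 1, 0, w 2, w 0] := by
      rw [fderiv_pi fun n => (contDiff_pi.1 ha n).differentiable (by simp) u]
      ext n
      fin_cases n <;> simp [a, dproj]
    have db : fderiv ℝ b u w = ![0, 0, w 3, w 0, w 4, 0] := by
      rw [fderiv_pi fun n => (contDiff_pi.1 hb n).differentiable (by simp) u]
      ext n
      fin_cases n <;> simp [b, dproj]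
    rw [da, Submodule.mem_span_singleton] at hwa
    rw [db, Submodule.mem_span_singleton] at hwb
    obtain ⟨r, hr⟩ := hwa
    obtain ⟨r', hr'⟩ := hwb
    -- The derivatives vanish in coordinate 0, where `a u` is 1, so both multipliers are 0.
    have r0 : r = 0 := by simpa [a] using congrFun hr 0
    have r0' : r' = 0 := by simpa [a] using congrFun hr' 0
    subst r0 r0'
    have e1 := congrFun hr 2
    have e2 := congrFun hr 4
    have e3 := congrFun hr' 2
    have e0 := congrFun hr' 3
    have e4 := congrFun hr' 4
    simp at e0 e1 e2 e3 e4
    ext n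
    fin_cases n <;> simp [← e0, ← e1, ← e2, ← e3, ← e4]
  · refine ⟨⟨a u, b u, ha0 u, rfl⟩, lineSet_subset_iff.2 fun t => ?_⟩
    rw [mem_reliabilityHypersurface]
    simp [bridgeValue, a, b]

theorem theorem4p5 :
    DependsOnAtLeast (linesIn reliabilityHypersurface) 5 ∧
      DependsOnAtMost (linesIn reliabilityHypersurface) 6 :=
  ⟨dependsOnAtLeast_five, dependsOnAtMost_six⟩
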